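/- Let $d\ge 1$. For a measurable set $K\subset\mathbb{R}^d$ write $\|\cdot\|_K$ for the norm of $L^2(K)$ (of scalar- or vector-valued functions), $h_K:=\operatorname{diam}(K)$, and, for $p\in\mathbb{N}_0$, let $\mathcal{P}_p(K)$ be the space of real polynomials in $d$ variables of total degree at most $p$, considered on $K$. We say that $K$ is star-shaped with respect to a ball $B(\mathbf{x},\rho_K)\subset K$, with $\rho_K>0$, if for every $\mathbf{y}\in K$ and every $\mathbf{z}\in B(\mathbf{x},\rho_K)$ the segment joining $\mathbf{z}$ and $\mathbf{y}$ is contained in $K$. (i) There is a constant $C(d)>0$, depending only on $d$, such that for every bounded measurable $K\subset\mathbb{R}^d$ (in particular, for every bounded domain) which is star-shaped with respect to a ball $B(\mathbf{x},\rho_K)\subset K$, every $p\in\mathbb{N}_0$ and every $v\in\mathcal{P}_p(K)$, \[ \|\nabla v\|_{K}^2\le C(d)\Big(\frac{h_K}{\rho_K}\Big)^{d+5}\frac{p^4}{\rho_K^2}\,\|v\|_{K}^2 . \] (ii) Consequently, for every $\kappa>0$ there is a constant $C(d,\kappa)>0$, depending only on $d$ and $\kappa$, such that for every $K$ as in (i)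 which in addition satisfies the shape-regularity condition $h_K\le\kappa\rho_K$, every $p\in\mathbb{N}_0$ and every $v\in\mathcal{P}_p(K)$, \[ \|\nabla v\|_{K}^2\le C(d,\kappa)\,\frac{p^4}{h_K^2}\,\|v\|_{K}^2 . \] -/

import Mathlib

/-- The space `P_p` of real polynomials of total degree at most `p` in `d` variables, regarded as
functions on Euclidean space `ℝ^d`. -/
def polySpace (d p : ℕ) : Set (EuclideanSpace ℝ (Fin d) → ℝ) :=
  {v | ∃ P : MvPolynomial (Fin d) ℝ, P.totalDegree ≤ p ∧
    ∀ y : EuclideanSpace ℝ (Fin d), v y = MvPolynomial.eval (fun i => y i) P}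

/-- `K` contains the ball `B(x, ρ)` and is star-shaped with respect to every point of it. -/
def IsStarShapedWrtBall {d : ℕ} (K : Set (EuclideanSpace ℝ (Fin d)))
    (x : EuclideanSpace ℝ (Fin d)) (ρ : ℝ) : Prop :=
  Metric.ball x ρ ⊆ K ∧ ∀ z ∈ Metric.ball x ρ, StarConvex ℝ z K

/-- The norm of `L²(K)` (Lebesgue measure), for scalar or vector valued functions. -/
noncomputable def l2Norm {d : ℕ} {F : Type*} [NormedAddCommGroup F]
    (K : Set (EuclideanSpace ℝ (Fin d))) (f : EuclideanSpace ℝ (Fin d) → F) : ℝ :=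
  Real.sqrt (∫ y in K, ‖f y‖ ^ 2)

/-! If K is star-convex about z, each ray from z meets K in a segment, up to endpoints, so polar
coordinates about z reduce an L² bound for the Euler derivative `fderiv ℝ v y (y - z)` to one for r
q'(r) on (0, R) with weight r^(d-1). That operator is scale invariant, so the constant depends on
neither R nor K. Taking z = x and z = x + (ρ/2) e_i, both in the ball, the difference of the two
Euler derivatives is (ρ/2) ∂_i v. This gives p^4/ρ² with no power of h/ρ; (i) and (ii) follow from ρ
≤ h and h ≤ κρ.

The one-dimensional Markov inequality is proved by induction on the degree. Split off the orthogonal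
polynomial φ of top degree n. Its Jacobi equation yields ‖rφ'‖² = n(n+a+1)(2n+a)‖φ‖², of order n³,
and a weighted Young inequality makes these constants add up to order n⁴. -/

open Polynomial in
/-- The functional `q ↦ ∫₀¹ q(r) r^a dr` on real polynomials. -/
noncomputable def powWeightIntegral (a : ℕ) : ℝ[X] →ₗ[ℝ] ℝ where
  toFun q := ∫ r in (0 : ℝ)..1, q.eval r * r ^ a
  map_add' q s := by
    rw [← intervalIntegral.integral_add (Continuous.intervalIntegrable (by fun_prop) _ _)
      (Continuous.intervalIntegrable (by fun_prop) _ _)]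
    simp [add_mul]
  map_smul' c q := by
    simp [mul_assoc]

/-! ### Orthogonal polynomials for the weight r^a on (0, 1). -/

namespace powWeightIntegral

open Polynomial

variable {a n : ℕ}

theorem apply_eq (a : ℕ) (q : ℝ[X]) :
    powWeightIntegral a q = ∫ r in (0 : ℝ)..1, q.eval r * r ^ a := rfl

/-- Integration by parts against the weight `r^a`. -/
theorem X_mul_derivative (a : ℕ) (q : ℝ[X]) :
    powWeightIntegral a (X * derivative q) = q.eval 1 - (a + 1) * powWeightIntegral a q := by
  have h : ∫ r in (0 : ℝ)..1, ((derivative q).eval r * r ^ (a + 1)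
      + q.eval r * ((a + 1 : ℕ) * r ^ a)) = q.eval 1 * 1 ^ (a + 1) - q.eval 0 * 0 ^ (a + 1) := by
    refine intervalIntegral.integral_eq_sub_of_hasDerivAt
      (f := fun r => q.eval r * r ^ (a + 1)) (fun r _ => ?_)
      (Continuous.intervalIntegrable (by fun_prop) _ _)
    exact (q.hasDerivAt r).mul (by simpa using hasDerivAt_pow (a + 1) r)
  rw [intervalIntegral.integral_add (Continuous.intervalIntegrable (by fun_prop) _ _)
      (Continuous.intervalIntegrable (by fun_prop) _ _)] at h
  have h1 : powWeightIntegral a (X * derivative q)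
      = ∫ r in (0 : ℝ)..1, (derivative q).eval r * r ^ (a + 1) := by
    rw [apply_eq]
    refine intervalIntegral.integral_congr fun r _ => ?_
    simp only [eval_mul, eval_X]
    ring
  have h2 : (a + 1) * powWeightIntegral a q
      = ∫ r in (0 : ℝ)..1, q.eval r * ((a + 1 : ℕ) * r ^ a) := by
    rw [apply_eq, ← intervalIntegral.integral_const_mul]
    refine intervalIntegral.integral_congr fun r _ => ?_
    push_cast
    ring
  rw [h1, h2]
  simp only [one_pow, mul_one, zero_pow (Nat.succ_ne_zero a), mul_zero, sub_zero] at h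
  linarith

theorem mono {q s : ℝ[X]} (h : ∀ r : ℝ, q.eval r ≤ s.eval r) :
    powWeightIntegral a q ≤ powWeightIntegral a s := by
  refine intervalIntegral.integral_mono_on zero_le_one
    (Continuous.intervalIntegrable (by fun_prop) _ _)
    (Continuous.intervalIntegrable (by fun_prop) _ _) fun r hr => ?_
  exact mul_le_mul_of_nonneg_right (h r) (pow_nonneg hr.1 a)

theorem sq_nonneg (q : ℝ[X]) : 0 ≤ powWeightIntegral a (q ^ 2) := by
  simpa using mono (a := a) (q := 0) (s := q ^ 2) fun r => by simpa using _root_.sq_nonneg _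

theorem sq_pos {q : ℝ[X]} (hq : q ≠ 0) : 0 < powWeightIntegral a (q ^ 2) := by
  obtain ⟨c, hc, hqc⟩ : ∃ c ∈ Set.Ioo (0 : ℝ) 1, q.eval c ≠ 0 := by
    by_contra! h
    refine hq (q.eq_zero_of_infinite_isRoot ((Set.Ioo_infinite zero_lt_one).mono ?_))
    exact fun c hc => h c hc
  rw [apply_eq]
  refine intervalIntegral.integral_pos zero_lt_one (by fun_prop) (fun r hr => ?_)
    ⟨c, ⟨hc.1.le, hc.2.le⟩, ?_⟩
  · have := hr.1.le
    simp only [eval_pow]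
    positivity
  · have := hc.1
    simp only [eval_pow]
    positivity

theorem eq_zero_of_sq {q : ℝ[X]} (h : powWeightIntegral a (q ^ 2) = 0) : q = 0 := by
  by_contra hq
  exact (sq_pos hq).ne' h

/-- There is a nonzero polynomial of degree `n` orthogonal to all polynomials of lower degree. -/
theorem exists_orthogonal (a n : ℕ) : ∃ φ : ℝ[X], φ.natDegree = n ∧ φ ≠ 0 ∧
    ∀ s : ℝ[X], s.degree < n → powWeightIntegral a (φ * s) = 0 := by
  let T : degreeLT ℝ (n + 1) →ₗ[ℝ] Module.Dual ℝ (degreeLT ℝ n) :=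
    ((LinearMap.mul ℝ ℝ[X]).compr₂ (powWeightIntegral a)).domRestrict₁₂ _ _
  -- Dimension n + 1 maps to dimension n, so some nonzero φ is orthogonal to everything of degree
  -- below n.
  have hT : LinearMap.ker T ≠ ⊥ := by
    refine T.ker_ne_bot_of_finrank_lt ?_
    rw [Subspace.dual_finrank_eq, Module.finrank_eq_card_basis (degreeLT.basis ℝ n),
      Module.finrank_eq_card_basis (degreeLT.basis ℝ (n + 1))]
    simp
  obtain ⟨φ, hφ, hφ0⟩ := (Submodule.ne_bot_iff _).1 hT
  have hφ0' : (φ : ℝ[X]) ≠ 0 := by simpa using hφ0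
  have horth : ∀ s : ℝ[X], s.degree < n → powWeightIntegral a (φ * s) = 0 := fun s hs =>
    DFunLike.congr_fun (LinearMap.mem_ker.1 hφ) (⟨s, mem_degreeLT.2 hs⟩ : degreeLT ℝ n)
  refine ⟨φ, le_antisymm ?_ ?_, hφ0', horth⟩
  · have := mem_degreeLT.1 φ.2
    rw [← natDegree_lt_iff_degree_lt hφ0'] at this
    omega
  -- If φ had degree below n it would be orthogonal to itself.
  · by_contra! hlt
    refine hφ0' (eq_zero_of_sq (a := a) ?_)
    rw [sq]
    exact horth _ ((natDegree_lt_iff_degree_lt hφ0').1 hlt)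

end powWeightIntegral

/-! ### The Jacobi equation and the exact norm of rφ'. -/

open Polynomial in
/-- The Jacobi operator `q ↦ -r^{-a} (r^{a+1} (1-r) q')'`. -/
noncomputable def jacobiOp (a : ℕ) (q : ℝ[X]) : ℝ[X] :=
  X * derivative (X * derivative q) + ((a : ℝ) + 1) • (X * derivative q)
    - (((a : ℝ) + 1) • derivative q + X * derivative (derivative q))

namespace powWeightIntegral

open Polynomial

variable {a n : ℕ}

theorem coeff_X_mul_derivative (q : ℝ[X]) (k : ℕ) :
    (X * derivative q).coeff k = k * q.coeff k := by
  cases k with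
  | zero => simp
  | succ k => rw [coeff_X_mul, coeff_derivative]; push_cast; ring

theorem coeff_jacobiOp (a : ℕ) (q : ℝ[X]) (k : ℕ) :
    (jacobiOp a q).coeff k
      = k * (k + a + 1) * q.coeff k - (k + 1) * (k + a + 1) * q.coeff (k + 1) := by
  simp only [jacobiOp, coeff_sub, coeff_add, coeff_smul, coeff_X_mul_derivative, smul_eq_mul,
    coeff_derivative]
  ring

theorem degree_jacobiOp_lt {q : ℝ[X]} (hq : q.degree < n) : (jacobiOp a q).degree < n := by
  rw [degree_lt_iff_coeff_zero] at hq ⊢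
  intro k hk
  rw [coeff_jacobiOp, hq k hk, hq (k + 1) (by omega)]
  simp

theorem eval_one_jacobiOp (a : ℕ) (q : ℝ[X]) :
    (jacobiOp a q).eval 1 = (derivative q).eval 1 := by
  simp only [jacobiOp, derivative_mul, derivative_X, eval_sub, eval_add, eval_mul, eval_smul,
    eval_X, eval_one, smul_eq_mul]
  ring

/-- Integration by parts: the boundary terms vanish because of 1 - r at 1 and r^(a+1) at 0. The
right side is symmetric in s and q. -/
theorem mul_jacobiOp (a : ℕ) (s q : ℝ[X]) :
    powWeightIntegral a (s * jacobiOp a q)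
      = powWeightIntegral a (X * (1 - X) * (derivative s * derivative q)) := by
  have h := X_mul_derivative a ((1 - X) * s * derivative q)
  have h0 : ((1 - X) * s * derivative q).eval (1 : ℝ) = 0 := by simp
  rw [h0] at h
  have h2 : X * (1 - X) * (derivative s * derivative q) - s * jacobiOp a q
      = X * derivative ((1 - X) * s * derivative q)
        + ((a : ℝ) + 1) • ((1 - X) * s * derivative q) := by
    simp only [jacobiOp, derivative_mul, derivative_sub, derivative_one, derivative_X,
      smul_eq_C_mul]
    ring
  have h3 := congrArg (powWeightIntegral a) h2
  rw [map_sub, map_add, map_smul, h, smul_eq_mul] at h3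
  linarith

theorem mul_jacobiOp_comm (a : ℕ) (s q : ℝ[X]) :
    powWeightIntegral a (s * jacobiOp a q) = powWeightIntegral a (q * jacobiOp a s) := by
  rw [mul_jacobiOp, mul_jacobiOp, mul_comm (derivative s)]

section Orthogonal

variable {φ : ℝ[X]} (hdeg : φ.natDegree = n)
  (horth : ∀ s : ℝ[X], s.degree < n → powWeightIntegral a (φ * s) = 0)

include hdeg horth

/-- An orthogonal polynomial of degree `n` sees only the coefficient of order `n`. -/
theorem orthogonal_mul {c : ℝ} {s : ℝ[X]} (hs : s.natDegree ≤ n)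
    (hc : s.coeff n = c * φ.coeff n) :
    powWeightIntegral a (φ * s) = c * powWeightIntegral a (φ ^ 2) := by
  have hlt : (s - c • φ).degree < n := by
    rw [degree_lt_iff_coeff_zero]
    intro k hk
    rcases hk.eq_or_lt with rfl | hk
    · simp [hc]
    · simp [coeff_eq_zero_of_natDegree_lt (hs.trans_lt hk),
        coeff_eq_zero_of_natDegree_lt (hdeg.le.trans_lt hk)]
  have h := horth _ hlt
  rw [mul_sub, map_sub, mul_smul_comm, map_smul, smul_eq_mul, ← sq] at h
  linarith

/-- The difference of the two sides has degree below n. By symmetry of the operator, which does not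
raise degree, it is also orthogonal to itself. -/
theorem jacobiOp_orthogonal : jacobiOp a φ = ((n : ℝ) * (n + a + 1)) • φ := by
  have hlt : (jacobiOp a φ - ((n : ℝ) * (n + a + 1)) • φ).degree < n := by
    rw [degree_lt_iff_coeff_zero]
    intro k hk
    rw [coeff_sub, coeff_smul, coeff_jacobiOp,
      coeff_eq_zero_of_natDegree_lt (p := φ) (n := k + 1) (by omega)]
    rcases hk.eq_or_lt with rfl | hk
    · simp
    · simp [coeff_eq_zero_of_natDegree_lt (hdeg.le.trans_lt hk)]
  rw [← sub_eq_zero]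
  refine eq_zero_of_sq (a := a) ?_
  set s := jacobiOp a φ - ((n : ℝ) * (n + a + 1)) • φ with hs
  have : s ^ 2 = s * jacobiOp a φ - ((n : ℝ) * (n + a + 1)) • (φ * s) := by
    rw [sq]
    nth_rewrite 2 [hs]
    rw [mul_sub, mul_smul_comm, mul_comm s φ]
  rw [this, map_sub, map_smul, horth s hlt, mul_jacobiOp_comm, horth _ (degree_jacobiOp_lt hlt)]
  simp

/-- Integrating by parts leaves the boundary term φ(1)φ'(1). The Jacobi equation at r = 1 gives
φ'(1) in terms of φ(1), and integrating (φ²)' gives φ(1)² in terms of ‖φ‖². -/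
theorem orthogonal_derivative_sq :
    powWeightIntegral a ((X * derivative φ) ^ 2)
      = n * (n + a + 1) * (2 * n + a) * powWeightIntegral a (φ ^ 2) := by
  have natDegree_euler : ∀ {q : ℝ[X]}, q.natDegree ≤ n → (X * derivative q).natDegree ≤ n := by
    intro q hq
    rw [natDegree_le_iff_coeff_eq_zero] at hq ⊢
    intro k hk
    rw [coeff_X_mul_derivative, hq k hk, mul_zero]
  have h1 : powWeightIntegral a (φ * (X * derivative φ)) = n * powWeightIntegral a (φ ^ 2) :=
    orthogonal_mul hdeg horth (natDegree_euler hdeg.le) (coeff_X_mul_derivative _ _)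
  have h2 : powWeightIntegral a (φ * (X * derivative (X * derivative φ)))
      = (n * n) * powWeightIntegral a (φ ^ 2) :=
    orthogonal_mul hdeg horth (natDegree_euler (natDegree_euler hdeg.le))
      (by rw [coeff_X_mul_derivative, coeff_X_mul_derivative]; ring)
  have h3 : (φ.eval 1) ^ 2 = (2 * n + a + 1) * powWeightIntegral a (φ ^ 2) := by
    have h := X_mul_derivative a (φ ^ 2)
    rw [show X * derivative (φ ^ 2) = (2 : ℝ) • (φ * (X * derivative φ)) by
      rw [derivative_pow, smul_eq_C_mul]; simp; ring, map_smul, h1, smul_eq_mul, eval_pow] at h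
    linarith
  have h4 : (derivative φ).eval 1 = n * (n + a + 1) * φ.eval 1 := by
    rw [← eval_one_jacobiOp a, jacobiOp_orthogonal hdeg horth, eval_smul, smul_eq_mul]
  have h5 := X_mul_derivative a (φ * (X * derivative φ))
  rw [show X * derivative (φ * (X * derivative φ))
      = (X * derivative φ) ^ 2 + φ * (X * derivative (X * derivative φ)) by
    rw [derivative_mul]; ring, map_add, h1, h2, eval_mul, eval_mul, eval_X, h4] at h5
  linear_combination h5 + n * (n + a + 1) * h3

end Orthogonal

/-! ### The one-dimensional Markov inequality. -/

/-- Inductive form of the weighted Markov inequality. -/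
theorem derivative_sq_le_add_one (a n : ℕ) {q : ℝ[X]} (hq : q.natDegree ≤ n) :
    powWeightIntegral a ((X * derivative q) ^ 2)
      ≤ ((a : ℝ) + 2) ^ 2 * (n ^ 4 + 1) * powWeightIntegral a (q ^ 2) := by
  induction n generalizing q with
  | zero =>
    rw [derivative_of_natDegree_zero (Nat.le_zero.1 hq)]
    have := sq_nonneg (a := a) q
    simp only [mul_zero, ne_eq, OfNat.ofNat_ne_zero, not_false_eq_true, zero_pow, map_zero]
    positivity
  | succ n ih =>
    obtain ⟨φ, hdeg, hφ, horth⟩ := exists_orthogonal a (n + 1)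
    have hlead : φ.coeff (n + 1) ≠ 0 := by
      rw [← hdeg]
      exact leadingCoeff_ne_zero.2 hφ
    obtain ⟨c, hc⟩ : ∃ c : ℝ, c = q.coeff (n + 1) / φ.coeff (n + 1) := ⟨_, rfl⟩
    obtain ⟨s, hs⟩ : ∃ s : ℝ[X], s = q - c • φ := ⟨_, rfl⟩
    have hsdeg : s.natDegree ≤ n := by
      rw [natDegree_le_iff_coeff_eq_zero]
      intro k hk
      rcases (Nat.succ_le_of_lt hk).eq_or_lt with rfl | hk
      · simp [hs, hc, hlead]
      · simp [hs, coeff_eq_zero_of_natDegree_lt (hq.trans_lt hk),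
          coeff_eq_zero_of_natDegree_lt (hdeg.le.trans_lt hk)]
    have hq' : q = s + c • φ := by rw [hs]; ring
    have hlow : s.degree < ((n + 1 : ℕ) : WithBot ℕ) := by
      rw [degree_lt_iff_coeff_zero]
      exact fun k hk => coeff_eq_zero_of_natDegree_lt (by omega)
    have hpyth : powWeightIntegral a (q ^ 2)
        = powWeightIntegral a (s ^ 2) + c ^ 2 * powWeightIntegral a (φ ^ 2) := by
      have : q ^ 2 = s ^ 2 + (2 * c) • (φ * s) + (c ^ 2) • φ ^ 2 := by
        rw [hq']
        simp only [smul_eq_C_mul, C_mul, C_pow, C_ofNat]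
        ring
      rw [this, map_add, map_add, map_smul, map_smul, horth s hlow]
      simp
    have hs' := ih hsdeg
    have hφ' := orthogonal_derivative_sq hdeg horth
    -- M is the constant for s, N the one for φ. The summand 1 keeps M positive when n = 0, since M
    -- is inverted below.
    obtain ⟨M, hM⟩ : ∃ M : ℝ, M = ((a : ℝ) + 2) ^ 2 * ((n : ℝ) ^ 4 + 1) := ⟨_, rfl⟩
    obtain ⟨N, hN⟩ : ∃ N : ℝ, N = ((a : ℝ) + 2) ^ 2 * ((n : ℝ) + 1) ^ 3 := ⟨_, rfl⟩
    have hMpos : 0 < M := by rw [hM]; positivity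
    have hNpos : 0 < N := by rw [hN]; positivity
    have hMN : M + N ≤ ((a : ℝ) + 2) ^ 2 * (((n + 1 : ℕ) : ℝ) ^ 4 + 1) := by
      rw [hM, hN, ← mul_add]
      refine mul_le_mul_of_nonneg_left ?_ (by positivity)
      push_cast
      have : (0 : ℝ) ≤ n := n.cast_nonneg
      nlinarith [pow_nonneg this 2, pow_nonneg this 3]
    have hφN : powWeightIntegral a ((X * derivative φ) ^ 2) ≤ N * powWeightIntegral a (φ ^ 2) := by
      rw [hφ', hN]
      refine mul_le_mul_of_nonneg_right ?_ (sq_nonneg φ)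
      push_cast
      have h0 : (0 : ℝ) ≤ n := n.cast_nonneg
      have h1 : (0 : ℝ) ≤ a := a.cast_nonneg
      calc ((n : ℝ) + 1) * (n + 1 + a + 1) * (2 * (n + 1) + a)
          ≤ ((n : ℝ) + 1) * ((a + 2) * (n + 1)) * ((a + 2) * (n + 1)) := by
            gcongr <;> nlinarith
        _ = _ := by ring
    -- Young's inequality (A + B)² ≤ (M + N)(A²/M + B²/N): the weights cancel the constants M and N,
    -- leaving (M + N)(‖s‖² + c²‖φ‖²).
    have hyoung : powWeightIntegral a ((X * derivative q) ^ 2)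
        ≤ (M + N) * (M⁻¹ * powWeightIntegral a ((X * derivative s) ^ 2)
          + N⁻¹ * (c ^ 2 * powWeightIntegral a ((X * derivative φ) ^ 2))) := by
      have := mono (a := a) (q := (X * derivative q) ^ 2)
        (s := (M + N) • (M⁻¹ • (X * derivative s) ^ 2
          + N⁻¹ • (c ^ 2) • (X * derivative φ) ^ 2)) fun r => ?_
      · simpa only [map_smul, map_add, smul_eq_mul] using this
      · rw [hq']
        simp only [derivative_add, derivative_smul, eval_pow, eval_mul, eval_X, eval_add,
          eval_smul, smul_eq_mul]
        rw [show (M + N) * (M⁻¹ * (r * eval r (derivative s)) ^ 2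
            + N⁻¹ * (c ^ 2 * (r * eval r (derivative φ)) ^ 2))
          = (r * (eval r (derivative s) + c * eval r (derivative φ))) ^ 2
            + M * N * (r * (eval r (derivative s) / M - c * eval r (derivative φ) / N)) ^ 2 by
              field_simp; ring]
        exact le_add_of_nonneg_right (by positivity)
    calc _ ≤ _ := hyoung
      _ ≤ (M + N) * (M⁻¹ * (M * powWeightIntegral a (s ^ 2))
          + N⁻¹ * (c ^ 2 * (N * powWeightIntegral a (φ ^ 2)))) := by
        rw [← hM] at hs'
        gcongr
      _ = (M + N) * powWeightIntegral a (q ^ 2) := by rw [hpyth]; field_simp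
      _ ≤ _ := mul_le_mul_of_nonneg_right hMN (sq_nonneg q)

/-- Markov's inequality in `L²(0, 1)` with weight `r^a`. -/
theorem derivative_sq_le (a p : ℕ) {q : ℝ[X]} (hq : q.natDegree ≤ p) :
    powWeightIntegral a ((X * derivative q) ^ 2)
      ≤ 2 * ((a : ℝ) + 2) ^ 2 * p ^ 4 * powWeightIntegral a (q ^ 2) := by
  rcases Nat.eq_zero_or_pos p with rfl | hp
  · rw [derivative_of_natDegree_zero (Nat.le_zero.1 hq)]
    simp
  · refine (derivative_sq_le_add_one a p hq).trans
      (mul_le_mul_of_nonneg_right ?_ (sq_nonneg q))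
    -- For p ≥ 1 the factor 2 absorbs the extra 1.
    have : (1 : ℝ) ≤ (p : ℝ) ^ 4 := one_le_pow₀ (by exact_mod_cast hp)
    rw [mul_comm 2, mul_assoc]
    refine mul_le_mul_of_nonneg_left (by linarith) (by positivity)

end powWeightIntegral

open Polynomial in
/-- Markov's inequality for the Euler operator `r ↦ r q'(r)` in `L²(0, R)` with weight `r^a`. -/
theorem integral_euler_sq_le (a p : ℕ) {q : ℝ[X]} (hq : q.natDegree ≤ p) {R : ℝ} (hR : 0 ≤ R) :
    ∫ r in (0 : ℝ)..R, (r * (derivative q).eval r) ^ 2 * r ^ a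
      ≤ 2 * ((a : ℝ) + 2) ^ 2 * p ^ 4 * ∫ r in (0 : ℝ)..R, (q.eval r) ^ 2 * r ^ a := by
  rcases hR.eq_or_lt with rfl | hR
  · simp
  have hdeg : (q.comp (C R * X)).natDegree ≤ p := by
    refine natDegree_comp_le.trans (le_trans ?_ hq)
    exact mul_le_of_le_one_right (Nat.zero_le _) (natDegree_C_mul_le R X |>.trans natDegree_X_le)
  have h := powWeightIntegral.derivative_sq_le a p hdeg
  have hscale : ∀ f : ℝ → ℝ, ∫ r in (0 : ℝ)..R, f r * r ^ a
      = R ^ (a + 1) * ∫ r in (0 : ℝ)..1, f (R * r) * r ^ a := by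
    intro f
    have := intervalIntegral.integral_comp_mul_left (a := 0) (b := 1)
      (fun r => f r * r ^ a) hR.ne'
    rw [mul_zero, mul_one, smul_eq_mul, eq_inv_mul_iff_mul_eq₀ hR.ne'] at this
    rw [← this, pow_succ', mul_assoc, ← intervalIntegral.integral_const_mul (R ^ a)]
    congr 1
    refine intervalIntegral.integral_congr fun r _ => ?_
    ring
  rw [hscale (fun r => (r * (derivative q).eval r) ^ 2), hscale (fun r => (q.eval r) ^ 2)]
  rw [powWeightIntegral.apply_eq, powWeightIntegral.apply_eq] at h
  simp only [eval_pow, eval_mul, eval_X, derivative_comp, eval_comp, derivative_C_mul,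
    derivative_X, mul_one, eval_C] at h
  rw [mul_left_comm]
  refine mul_le_mul_of_nonneg_left (le_trans (le_of_eq ?_) h) (by positivity)
  refine intervalIntegral.integral_congr fun r _ => ?_
  ring

/-! ### Polar coordinates and radial sections. -/

open MeasureTheory Measure Set Metric in
/-- Integration in polar coordinates for nonnegative measurable functions. -/
theorem lintegral_eq_lintegral_sphere_Ioi {E : Type*} [NormedAddCommGroup E] [NormedSpace ℝ E]
    [FiniteDimensional ℝ E] [MeasurableSpace E] [BorelSpace E] [Nontrivial E]
    (μ : Measure E) [μ.IsAddHaarMeasure] {f : E → ENNReal} (hf : Measurable f) :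
    ∫⁻ y, f y ∂μ = ∫⁻ θ : sphere (0 : E) 1, (∫⁻ r in Ioi (0 : ℝ),
      ENNReal.ofReal (r ^ (Module.finrank ℝ E - 1)) * f (r • (θ : E))) ∂μ.toSphere := by
  have hg : Measurable fun x : sphere (0 : E) 1 × Ioi (0 : ℝ) => f (x.2.1 • x.1.1) :=
    hf.comp (by fun_prop)
  calc ∫⁻ y, f y ∂μ = ∫⁻ y : ({(0)}ᶜ : Set E), f y ∂(μ.comap (↑)) := by
        rw [lintegral_subtype_comap (measurableSet_singleton _).compl, restrict_compl_singleton]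
    _ = ∫⁻ x, f (x.2.1 • x.1.1) ∂(μ.toSphere.prod (volumeIoiPow (Module.finrank ℝ E - 1))) := by
        rw [← μ.measurePreserving_homeomorphUnitSphereProd.lintegral_comp_emb
          (Homeomorph.measurableEmbedding _)]
        refine lintegral_congr fun y => ?_
        have : ‖(y : E)‖ ≠ 0 := norm_ne_zero_iff.2 y.2
        simp [smul_smul, this]
    _ = _ := by
        rw [lintegral_prod _ hg.aemeasurable]
        refine lintegral_congr fun θ => ?_
        have hθ : Measurable fun r : Ioi (0 : ℝ) => f (r.1 • (θ : E)) := hf.comp (by fun_prop)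
        rw [volumeIoiPow, lintegral_withDensity_eq_lintegral_mul _ (by fun_prop) hθ]
        exact lintegral_subtype_comap measurableSet_Ioi
          fun r => ENNReal.ofReal (r ^ (Module.finrank ℝ E - 1)) * f (r • (θ : E))

open MeasureTheory Set in
/-- Radial integrals over a bounded initial segment of the half-line are interval integrals. -/
theorem exists_lintegral_ray_eq (a : ℕ) {S : Set ℝ} (hS : MeasurableSet S) (hb : BddAbove S)
    (hdown : ∀ r ∈ S, ∀ s, 0 < s → s ≤ r → s ∈ S) :
    ∃ R : ℝ, 0 ≤ R ∧ ∀ f : ℝ → ℝ, Continuous f → (∀ r, 0 ≤ f r) →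
      ∫⁻ r in Ioi (0 : ℝ), ENNReal.ofReal (r ^ a) * S.indicator (fun r => ENNReal.ofReal (f r)) r
        = ENNReal.ofReal (∫ r in (0 : ℝ)..R, f r * r ^ a) := by
  -- R is the supremum of the positive part of S, or 0 if that is empty; whether it is attained does
  -- not matter almost everywhere.
  obtain ⟨R, hR, hSR⟩ : ∃ R : ℝ, 0 ≤ R ∧ (S ∩ Ioi 0 : Set ℝ) =ᵐ[volume] Ioc 0 R := by
    rcases (S ∩ Ioi 0).eq_empty_or_nonempty with h | h
    · exact ⟨0, le_rfl, by simp [h]⟩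
    · have hb' : BddAbove (S ∩ Ioi 0) := hb.mono inter_subset_left
      obtain ⟨r₀, hr₀⟩ := h
      have hle : ∀ r ∈ S ∩ Ioi 0, r ≤ sSup (S ∩ Ioi 0) := fun r hr => le_csSup hb' hr
      refine ⟨sSup (S ∩ Ioi 0), (mem_Ioi.1 hr₀.2).le.trans (hle _ hr₀), ?_⟩
      have h1 : Ioo 0 (sSup (S ∩ Ioi 0)) ⊆ S ∩ Ioi 0 := by
        intro s hs
        obtain ⟨r, hr, hsr⟩ := exists_lt_of_lt_csSup ⟨r₀, hr₀⟩ hs.2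
        exact ⟨hdown r hr.1 s hs.1 hsr.le, hs.1⟩
      have h2 : S ∩ Ioi 0 ⊆ Ioc 0 (sSup (S ∩ Ioi 0)) := fun s hs => ⟨hs.2, hle s hs⟩
      exact h2.eventuallyLE.antisymm (Ioo_ae_eq_Ioc.symm.le.trans h1.eventuallyLE)
  refine ⟨R, hR, fun f hf hf0 => ?_⟩
  calc ∫⁻ r in Ioi (0 : ℝ), ENNReal.ofReal (r ^ a) * S.indicator (fun r => ENNReal.ofReal (f r)) r
      = ∫⁻ r in Ioi (0 : ℝ), S.indicator (fun r => ENNReal.ofReal (f r * r ^ a)) r := by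
        refine lintegral_congr fun r => ?_
        by_cases hr : r ∈ S
        · simp [hr, ENNReal.ofReal_mul (hf0 r), mul_comm]
        · simp [hr]
    _ = ∫⁻ r in Ioc 0 R, ENNReal.ofReal (f r * r ^ a) := by
        rw [lintegral_indicator hS, Measure.restrict_restrict hS, setLIntegral_congr hSR]
    _ = _ := by
        rw [intervalIntegral.integral_of_le hR, ofReal_integral_eq_lintegral_ofReal]
        · exact ((hf.mul (continuous_pow a)).intervalIntegrable 0 R).1
        · filter_upwards [ae_restrict_mem measurableSet_Ioc] with r hr
          exact mul_nonneg (hf0 r) (pow_nonneg hr.1.le a)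

/-! ### Polynomials on star-shaped sets. -/

namespace polySpace

variable {d p : ℕ} {v : EuclideanSpace ℝ (Fin d) → ℝ}

theorem contDiff (hv : v ∈ polySpace d p) : ContDiff ℝ 1 v := by
  obtain ⟨P, -, hP⟩ := hv
  have : v = fun y => MvPolynomial.aeval (fun i => y i) P := by
    funext y
    rw [hP, MvPolynomial.aeval_def, MvPolynomial.eval₂_eq_eval_map]
    simp
  rw [this, contDiff_iff_contDiffAt]
  refine fun y => AnalyticAt.contDiffAt (AnalyticAt.aeval_mvPolynomial (fun i => ?_) P)
  exact (EuclideanSpace.proj (𝕜 := ℝ) i).analyticAt y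

/-- The restriction of a polynomial to a line is a polynomial of no larger degree. -/
theorem exists_polynomial_line (hv : v ∈ polySpace d p) (z w : EuclideanSpace ℝ (Fin d)) :
    ∃ q : Polynomial ℝ, q.natDegree ≤ p ∧ (∀ r : ℝ, q.eval r = v (z + r • w)) ∧
      ∀ r : ℝ, q.derivative.eval r = fderiv ℝ v (z + r • w) w := by
  have hdiff := (contDiff hv).differentiable one_ne_zero
  obtain ⟨P, hPdeg, hP⟩ := hv
  let ℓ : Fin d → Polynomial ℝ := fun i => Polynomial.C (z i) + Polynomial.C (w i) * Polynomial.X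
  have heval : ∀ r : ℝ, (MvPolynomial.aeval ℓ P).eval r = v (z + r • w) := by
    intro r
    rw [hP, ← Polynomial.coe_evalRingHom, MvPolynomial.aeval_def, MvPolynomial.hom_eval₂,
      MvPolynomial.eval, MvPolynomial.coe_eval₂Hom]
    congr 1
    · ext; simp
    · funext i
      simp [ℓ, mul_comm (w i)]
  refine ⟨MvPolynomial.aeval ℓ P, ?_, heval, fun r => ?_⟩
  · rw [← mul_one p]
    refine MvPolynomial.aeval_natDegree_le P hPdeg ℓ fun i => ?_
    simp only [ℓ]
    compute_degree
  · have h1 := (MvPolynomial.aeval ℓ P).hasDerivAt r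
    rw [show (fun r => (MvPolynomial.aeval ℓ P).eval r) = fun r : ℝ => v (z + r • w) from
      funext heval] at h1
    have h2 : HasDerivAt (fun r : ℝ => z + r • w) w r := by
      simpa using ((hasDerivAt_id r).smul_const w).const_add z
    exact h1.unique ((hdiff (z + r • w)).hasFDerivAt.comp_hasDerivAt r h2)

open MeasureTheory Set in
/-- On a bounded set that is star-convex about `z`, the Euler derivative about `z` of a polynomial
obeys a Markov inequality whose constant is independent of the set. -/
theorem lintegral_euler_sq_le (hd : 1 ≤ d) (hv : v ∈ polySpace d p)
    {K : Set (EuclideanSpace ℝ (Fin d))} (hK : MeasurableSet K) (hb : Bornology.IsBounded K)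
    {z : EuclideanSpace ℝ (Fin d)} (hz : StarConvex ℝ z K) :
    ∫⁻ y in K, ENNReal.ofReal ((fderiv ℝ v y (y - z)) ^ 2)
      ≤ ENNReal.ofReal (2 * ((d : ℝ) + 1) ^ 2 * p ^ 4)
        * ∫⁻ y in K, ENNReal.ofReal (v y ^ 2) := by
  have : NeZero d := ⟨by omega⟩
  have hv1 := contDiff hv
  have hfd : Continuous fun y => fderiv ℝ v y (y - z) :=
    (hv1.continuous_fderiv one_ne_zero).clm_apply (by fun_prop)
  have hpolar : ∀ F : EuclideanSpace ℝ (Fin d) → ℝ, Continuous F →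
      ∫⁻ y in K, ENNReal.ofReal (F y) = ∫⁻ θ : Metric.sphere (0 : EuclideanSpace ℝ (Fin d)) 1,
        (∫⁻ r in Ioi (0 : ℝ), ENNReal.ofReal (r ^ (d - 1)) *
          {r : ℝ | z + r • (θ : EuclideanSpace ℝ (Fin d)) ∈ K}.indicator
            (fun r => ENNReal.ofReal (F (z + r • (θ : EuclideanSpace ℝ (Fin d))))) r)
        ∂(volume : Measure (EuclideanSpace ℝ (Fin d))).toSphere := by
    intro F hF
    have hm : Measurable (K.indicator fun y => ENNReal.ofReal (F y)) :=
      (hF.measurable.ennreal_ofReal).indicator hK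
    have hmz : Measurable fun y => K.indicator (fun y => ENNReal.ofReal (F y)) (z + y) :=
      hm.comp (by fun_prop)
    rw [← lintegral_indicator hK, ← lintegral_add_left_eq_self _ z,
      lintegral_eq_lintegral_sphere_Ioi _ hmz, finrank_euclideanSpace_fin]
    rfl
  rw [hpolar (fun y => (fderiv ℝ v y (y - z)) ^ 2) (hfd.pow 2),
    hpolar (fun y => v y ^ 2) (hv1.continuous.pow 2),
    ← lintegral_const_mul' _ _ ENNReal.ofReal_ne_top]
  refine lintegral_mono fun θ => ?_
  have hθ : ‖(θ : EuclideanSpace ℝ (Fin d))‖ = 1 := by simp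
  obtain ⟨q, hqdeg, hq, hq'⟩ := exists_polynomial_line hv z (θ : EuclideanSpace ℝ (Fin d))
  have hS : MeasurableSet {r : ℝ | z + r • (θ : EuclideanSpace ℝ (Fin d)) ∈ K} := by
    refine hK.preimage (f := fun r : ℝ => z + r • (θ : EuclideanSpace ℝ (Fin d))) ?_
    fun_prop
  have hSb : BddAbove {r : ℝ | z + r • (θ : EuclideanSpace ℝ (Fin d)) ∈ K} := by
    obtain ⟨B, hB⟩ := hb.subset_closedBall z
    refine ⟨B, fun r hr => ?_⟩
    have := hB hr
    rw [mem_closedBall_iff_norm, add_sub_cancel_left, norm_smul, hθ, mul_one] at this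
    exact (le_abs_self r).trans this
  -- Star-convexity about z makes the section along the ray closed under shrinking r.
  obtain ⟨R, hR, hray⟩ := exists_lintegral_ray_eq (d - 1) hS hSb fun r hr s hs hsr => by
    have hr0 : 0 < r := hs.trans_le hsr
    have := hz.add_smul_sub_mem hr (div_nonneg hs.le hr0.le) ((div_le_one hr0).2 hsr)
    rwa [add_sub_cancel_left, smul_smul, div_mul_cancel₀ _ hr0.ne'] at this
  have hc : ((d - 1 : ℕ) : ℝ) + 2 = d + 1 := by
    rw [Nat.cast_sub hd]; push_cast; ring
  have hmarkov := integral_euler_sq_le (d - 1) p hqdeg hR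
  rw [hc] at hmarkov
  have e1 : (fun r : ℝ => (fderiv ℝ v (z + r • (θ : EuclideanSpace ℝ (Fin d)))
      (z + r • (θ : EuclideanSpace ℝ (Fin d)) - z)) ^ 2)
      = fun r => (r * q.derivative.eval r) ^ 2 := by
    funext r
    rw [add_sub_cancel_left, map_smul, hq', smul_eq_mul]
  have e2 : (fun r : ℝ => v (z + r • (θ : EuclideanSpace ℝ (Fin d))) ^ 2)
      = fun r => (q.eval r) ^ 2 := by
    funext r
    rw [hq]
  have l1 := hray _ (by rw [e1]; fun_prop) fun r => sq_nonneg (fderiv ℝ v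
    (z + r • (θ : EuclideanSpace ℝ (Fin d))) (z + r • (θ : EuclideanSpace ℝ (Fin d)) - z))
  have l2 := hray _ (by rw [e2]; fun_prop) fun r => sq_nonneg
    (v (z + r • (θ : EuclideanSpace ℝ (Fin d))))
  rw [l1, l2, ← ENNReal.ofReal_mul (by positivity)]
  refine ENNReal.ofReal_le_ofReal ?_
  simp only [funext_iff] at e1 e2
  simpa only [e1, e2] using hmarkov

open MeasureTheory in
theorem integrableOn_of_continuous {f : EuclideanSpace ℝ (Fin d) → ℝ} (hf : Continuous f)
    {K : Set (EuclideanSpace ℝ (Fin d))} (hb : Bornology.IsBounded K) : IntegrableOn f K := by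
  obtain ⟨B, hB⟩ := hb.subset_closedBall 0
  exact (hf.continuousOn.integrableOn_compact (isCompact_closedBall 0 B)).mono_set hB

open MeasureTheory in
theorem integral_euler_sq_le (hd : 1 ≤ d) (hv : v ∈ polySpace d p)
    {K : Set (EuclideanSpace ℝ (Fin d))} (hK : MeasurableSet K) (hb : Bornology.IsBounded K)
    {z : EuclideanSpace ℝ (Fin d)} (hz : StarConvex ℝ z K) :
    ∫ y in K, (fderiv ℝ v y (y - z)) ^ 2
      ≤ 2 * ((d : ℝ) + 1) ^ 2 * p ^ 4 * ∫ y in K, v y ^ 2 := by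
  have hv1 := contDiff hv
  have hfd : Continuous fun y => fderiv ℝ v y (y - z) :=
    (hv1.continuous_fderiv one_ne_zero).clm_apply (by fun_prop)
  have hv0 : 0 ≤ ∫ y in K, v y ^ 2 := integral_nonneg fun y => sq_nonneg _
  have hI1 : IntegrableOn (fun y => (fderiv ℝ v y (y - z)) ^ 2) K :=
    integrableOn_of_continuous (hfd.pow 2) hb
  have hI2 : IntegrableOn (fun y => v y ^ 2) K :=
    integrableOn_of_continuous (hv1.continuous.pow 2) hb
  have h := lintegral_euler_sq_le hd hv hK hb hz
  rw [← ofReal_integral_eq_lintegral_ofReal hI1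
      (Filter.Eventually.of_forall fun y => sq_nonneg _),
    ← ofReal_integral_eq_lintegral_ofReal hI2
      (Filter.Eventually.of_forall fun y => sq_nonneg _),
    ← ENNReal.ofReal_mul (by positivity)] at h
  exact (ENNReal.ofReal_le_ofReal_iff (by positivity)).1 h

open MeasureTheory in
/-- Markov's inequality on a set that is star-shaped with respect to a ball of radius `ρ`. -/
theorem integral_gradient_sq_le (hd : 1 ≤ d) (hv : v ∈ polySpace d p)
    {K : Set (EuclideanSpace ℝ (Fin d))} (hK : MeasurableSet K) (hb : Bornology.IsBounded K)
    {x : EuclideanSpace ℝ (Fin d)} {ρ : ℝ} (hρ : 0 < ρ) (hstar : IsStarShapedWrtBall K x ρ) :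
    ∫ y in K, ‖gradient v y‖ ^ 2
      ≤ 32 * d * ((d : ℝ) + 1) ^ 2 * (p ^ 4 / ρ ^ 2) * ∫ y in K, v y ^ 2 := by
  have hv1 := contDiff hv
  have hfd : ∀ z, Continuous fun y => fderiv ℝ v y (y - z) := fun z =>
    (hv1.continuous_fderiv one_ne_zero).clm_apply (by fun_prop)
  let e : Fin d → EuclideanSpace ℝ (Fin d) := fun i => EuclideanSpace.basisFun (Fin d) ℝ i
  have he : ∀ i, ‖e i‖ = 1 := fun i => (EuclideanSpace.basisFun (Fin d) ℝ).norm_eq_one i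
  -- Half the radius keeps z i inside the open ball.
  let z : Fin d → EuclideanSpace ℝ (Fin d) := fun i => x + (ρ / 2) • e i
  have hz : ∀ i, StarConvex ℝ (z i) K := fun i => hstar.2 _ <| by
    rw [mem_ball_iff_norm, add_sub_cancel_left, norm_smul, he, Real.norm_eq_abs,
      abs_of_pos (by positivity)]
    linarith
  -- The 8 is (2/ρ)² ρ² times the 2 of (A - B)² ≤ 2A² + 2B².
  have hpt : ∀ y, ‖gradient v y‖ ^ 2 ≤ ∑ i, (8 / ρ ^ 2 * (fderiv ℝ v y (y - x)) ^ 2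
      + 8 / ρ ^ 2 * (fderiv ℝ v y (y - z i)) ^ 2) := by
    intro y
    rw [← (EuclideanSpace.basisFun (Fin d) ℝ).sum_sq_inner_left (gradient v y)]
    refine Finset.sum_le_sum fun i _ => ?_
    have h1 : inner ℝ (gradient v y) (e i) = fderiv ℝ v y (e i) := by
      rw [gradient, InnerProductSpace.toDual_symm_apply]
    have h2 : fderiv ℝ v y (e i) = 2 / ρ * (fderiv ℝ v y (y - x) - fderiv ℝ v y (y - z i)) := by
      rw [← map_sub, show y - x - (y - z i) = (ρ / 2) • e i by simp [z], map_smul, smul_eq_mul]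
      field_simp
    change (inner ℝ (gradient v y) (e i)) ^ 2 ≤ _
    rw [h1, h2, mul_pow, div_pow, ← mul_add,
      show (8 : ℝ) / ρ ^ 2 = 2 ^ 2 / ρ ^ 2 * 2 by ring, mul_assoc]
    refine mul_le_mul_of_nonneg_left ?_ (by positivity)
    linarith [sub_sq (fderiv ℝ v y (y - x)) (fderiv ℝ v y (y - z i)),
      add_sq (fderiv ℝ v y (y - x)) (fderiv ℝ v y (y - z i)),
      sq_nonneg (fderiv ℝ v y (y - x) + fderiv ℝ v y (y - z i))]
  have hint : ∀ w, IntegrableOn (fun y => 8 / ρ ^ 2 * (fderiv ℝ v y (y - w)) ^ 2) K := fun w =>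
    integrableOn_of_continuous (continuous_const.mul ((hfd w).pow 2)) hb
  have hint2 : ∀ i, IntegrableOn (fun y => 8 / ρ ^ 2 * (fderiv ℝ v y (y - x)) ^ 2
      + 8 / ρ ^ 2 * (fderiv ℝ v y (y - z i)) ^ 2) K := fun i => (hint x).add (hint (z i))
  have hgrad : Continuous (gradient v) :=
    (InnerProductSpace.toDual ℝ _).symm.continuous.comp (hv1.continuous_fderiv one_ne_zero)
  have hx := integral_euler_sq_le hd hv hK hb (hstar.2 x (Metric.mem_ball_self hρ))
  calc ∫ y in K, ‖gradient v y‖ ^ 2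
      ≤ ∫ y in K, ∑ i, (8 / ρ ^ 2 * (fderiv ℝ v y (y - x)) ^ 2
        + 8 / ρ ^ 2 * (fderiv ℝ v y (y - z i)) ^ 2) := by
        refine integral_mono (integrableOn_of_continuous (hgrad.norm.pow 2) hb)
          (integrable_finsetSum _ fun i _ => hint2 i) hpt
    _ = ∑ i, (8 / ρ ^ 2 * (∫ y in K, (fderiv ℝ v y (y - x)) ^ 2)
        + 8 / ρ ^ 2 * ∫ y in K, (fderiv ℝ v y (y - z i)) ^ 2) := by
        rw [integral_finsetSum _ fun i _ => hint2 i]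
        refine Finset.sum_congr rfl fun i _ => ?_
        rw [integral_add (hint x) (hint (z i)), integral_const_mul, integral_const_mul]
    _ ≤ ∑ _i : Fin d, (8 / ρ ^ 2 * (2 * ((d : ℝ) + 1) ^ 2 * p ^ 4 * ∫ y in K, v y ^ 2)
        + 8 / ρ ^ 2 * (2 * ((d : ℝ) + 1) ^ 2 * p ^ 4 * ∫ y in K, v y ^ 2)) := by
        gcongr with i
        exact integral_euler_sq_le hd hv hK hb (hz i)
    _ = _ := by
        rw [Finset.sum_const, Finset.card_univ, Fintype.card_fin, nsmul_eq_mul]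
        ring

end polySpace

/-! ### Comparison of ρ with the diameter, and the final estimates. -/

theorem IsStarShapedWrtBall.le_diam {d : ℕ} (hd : 1 ≤ d) {K : Set (EuclideanSpace ℝ (Fin d))}
    (hb : Bornology.IsBounded K) {x : EuclideanSpace ℝ (Fin d)} {ρ : ℝ} (hρ : 0 < ρ)
    (hstar : IsStarShapedWrtBall K x ρ) : ρ ≤ Metric.diam K := by
  have : NeZero d := ⟨by omega⟩
  obtain ⟨e, he⟩ := exists_norm_eq (EuclideanSpace ℝ (Fin d)) zero_le_one
  refine le_of_forall_lt_imp_le_of_dense fun t ht => ?_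
  rcases le_total t 0 with ht0 | ht0
  · exact ht0.trans Metric.diam_nonneg
  have hmem : x + t • e ∈ Metric.ball x ρ := by
    rw [mem_ball_iff_norm, add_sub_cancel_left, norm_smul, he, mul_one, Real.norm_eq_abs,
      abs_of_nonneg ht0]
    exact ht
  have := Metric.dist_le_diam_of_mem hb (hstar.1 hmem) (hstar.1 (Metric.mem_ball_self hρ))
  rwa [dist_eq_norm, add_sub_cancel_left, norm_smul, he, mul_one, Real.norm_eq_abs,
    abs_of_nonneg ht0] at this

theorem l2Norm_sq {d : ℕ} {F : Type*} [NormedAddCommGroup F]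
    (K : Set (EuclideanSpace ℝ (Fin d))) (f : EuclideanSpace ℝ (Fin d) → F) :
    l2Norm K f ^ 2 = ∫ y in K, ‖f y‖ ^ 2 :=
  Real.sq_sqrt (MeasureTheory.integral_nonneg fun y => by positivity)

theorem l2Norm_gradient_sq_le {d : ℕ} (hd : 1 ≤ d) {K : Set (EuclideanSpace ℝ (Fin d))}
    {x : EuclideanSpace ℝ (Fin d)} {ρ : ℝ} (hK : MeasurableSet K) (hb : Bornology.IsBounded K)
    (hρ : 0 < ρ) (hstar : IsStarShapedWrtBall K x ρ) {p : ℕ} {v : EuclideanSpace ℝ (Fin d) → ℝ}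
    (hv : v ∈ polySpace d p) :
    l2Norm K (gradient v) ^ 2
      ≤ 32 * d * ((d : ℝ) + 1) ^ 2 * (p ^ 4 / ρ ^ 2) * l2Norm K v ^ 2 := by
  simp only [l2Norm_sq, Real.norm_eq_abs, sq_abs]
  exact polySpace.integral_gradient_sq_le hd hv hK hb hρ hstar

theorem mainTheorem10 (d : ℕ) (hd : 1 ≤ d) :
    (∃ C : ℝ, 0 < C ∧
      ∀ (K : Set (EuclideanSpace ℝ (Fin d))) (x : EuclideanSpace ℝ (Fin d)) (ρ : ℝ),
        MeasurableSet K → Bornology.IsBounded K → 0 < ρ → IsStarShapedWrtBall K x ρ →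
        ∀ (p : ℕ), ∀ v ∈ polySpace d p,
          l2Norm K (gradient v) ^ 2 ≤
            C * (Metric.diam K / ρ) ^ (d + 5) * ((p : ℝ) ^ 4 / ρ ^ 2) * l2Norm K v ^ 2) ∧
    (∀ κ : ℝ, 0 < κ → ∃ C : ℝ, 0 < C ∧
      ∀ (K : Set (EuclideanSpace ℝ (Fin d))) (x : EuclideanSpace ℝ (Fin d)) (ρ : ℝ),
        MeasurableSet K → Bornology.IsBounded K → 0 < ρ → IsStarShapedWrtBall K x ρ →
        Metric.diam K ≤ κ * ρ →
        ∀ (p : ℕ), ∀ v ∈ polySpace d p,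
          l2Norm K (gradient v) ^ 2 ≤
            C * ((p : ℝ) ^ 4 / Metric.diam K ^ 2) * l2Norm K v ^ 2) := by
  have hd' : (0 : ℝ) < d := by exact_mod_cast hd
  refine ⟨⟨32 * d * ((d : ℝ) + 1) ^ 2, by positivity, ?_⟩, fun κ hκ =>
    ⟨32 * d * ((d : ℝ) + 1) ^ 2 * κ ^ 2, by positivity, ?_⟩⟩
  · intro K x ρ hK hb hρ hstar p v hv
    refine (l2Norm_gradient_sq_le hd hK hb hρ hstar hv).trans ?_
    -- The power of h/ρ is at least 1, so it only weakens the bound already proved.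
    have h1 : 1 ≤ (Metric.diam K / ρ) ^ (d + 5) :=
      one_le_pow₀ ((one_le_div hρ).2 (hstar.le_diam hd hb hρ))
    refine mul_le_mul_of_nonneg_right (mul_le_mul_of_nonneg_right ?_ (by positivity))
      (by positivity)
    exact le_mul_of_one_le_right (by positivity) h1
  · intro K x ρ hK hb hρ hstar hκρ p v hv
    refine (l2Norm_gradient_sq_le hd hK hb hρ hstar hv).trans ?_
    have hdiam : 0 < Metric.diam K := hρ.trans_le (hstar.le_diam hd hb hρ)
    rw [mul_assoc _ (κ ^ 2)]
    gcongr
    rw [mul_div_assoc', div_le_div_iff₀ (by positivity) (by positivity)]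
    calc (p : ℝ) ^ 4 * Metric.diam K ^ 2 ≤ (p : ℝ) ^ 4 * (κ * ρ) ^ 2 := by gcongr
      _ = _ := by ring
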